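/- Let $(\lambda_k)_{k\ge 0}$ be a sequence of reals with $0<\lambda_0<\lambda_1<\lambda_2<\cdots$, $\lambda_k\to\infty$ and $\lambda_{k+1}/\lambda_k\to 1$; put $\lambda_{-1}=0$. Let $\hat p=(p_n)_{n\ge 0}$ be a sequence of reals with $p_n>1$ for all $n$. For a real sequence $x=(x_k)_{k\ge0}$ let $$\sigma(x)=\sum_{n=0}^\infty\Bigl(\frac1{\lambda_n}\sum_{k=0}^n(\lambda_k-\lambda_{k-1})|x_k|\Bigr)^{p_n}\in[0,\infty],$$ and let $\Lambda_{\hat p}=\{x:\sigma(rx)<\infty\text{ for some }r>0\}$, equipped with the Luxemburg norm $\|x\|_{\hat p}=\inf\{r>0:\sigma(x/r)\le 1\}$. For a Banach space $X$ the weakly convergent sequence coefficient is $$WCS(X)=\inf\frac{\limsup_{k}\,\sup_{n,m\ge k}\|x_n-x_m\|}{\inf\{\limsup_n\|x_n-y\|:y\in\operatorname{conv}\{x_n:n\ge0\}\}},$$ the infimum being taken over all sequences $(x_n)$ in $X$ that converge weakly but not in norm (with $\inf\emptyset=+\infty$), and $X$ is said to have weak uniform normal structure if $WCS(X)>1$.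 If $\limsup_{n\to\infty}p_n<\infty$, then $\Lambda_{\hat p}$ has weak uniform normal structure. -/

import Mathlib

open Filter Topology
open scoped ENNReal

noncomputable section

namespace LambdaSeq

/-- The standing assumptions on `Λ = (lam k)`: `0 < lam 0 < lam 1 < ...`, `lam k → ∞` and
`lam (k+1) / lam k → 1`. -/
structure IsLambdaSeq (lam : ℕ → ℝ) : Prop where
  pos : 0 < lam 0
  strictMono : StrictMono lam
  tendsto_atTop : Tendsto lam atTop atTop
  tendsto_ratio : Tendsto (fun k => lam (k + 1) / lam k) atTop (𝓝 1)

/-- The differences `lam k - lam (k-1)`, with the convention `lam (-1) = 0`. -/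
def gap (lam : ℕ → ℝ) : ℕ → ℝ
  | 0 => lam 0
  | k + 1 => lam (k + 1) - lam k

/-- The weighted mean `Λx(n) = (1 / lam n) * ∑_{k ≤ n} (lam k - lam (k-1)) |x k|`. -/
def mean (lam : ℕ → ℝ) (x : ℕ → ℝ) (n : ℕ) : ℝ :=
  (1 / lam n) * ∑ k ∈ Finset.range (n + 1), gap lam k * |x k|

/-- The convex modular `σ(x) = ∑ₙ (Λx(n)) ^ (p n)`, with values in `[0, ∞]`. -/
def modular (lam p : ℕ → ℝ) (x : ℕ → ℝ) : ℝ≥0∞ :=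
  ∑' n, ENNReal.ofReal (mean lam x n ^ p n)

/-- The Luxemburg functional `inf {r > 0 : σ(x / r) ≤ 1}`. -/
def luxemburg (lam p : ℕ → ℝ) (x : ℕ → ℝ) : ℝ :=
  sInf {r : ℝ | 0 < r ∧ modular lam p (r⁻¹ • x) ≤ 1}

section lemmas

variable {lam p : ℕ → ℝ}

theorem IsLambdaSeq.lam_pos (h : IsLambdaSeq lam) (n : ℕ) : 0 < lam n :=
  h.pos.trans_le (h.strictMono.monotone (Nat.zero_le n))

theorem IsLambdaSeq.gap_pos (h : IsLambdaSeq lam) (k : ℕ) : 0 < gap lam k := by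
  cases k with
  | zero => exact h.pos
  | succ k => exact sub_pos.2 (h.strictMono (Nat.lt_succ_self k))

theorem mean_nonneg (h : IsLambdaSeq lam) (x : ℕ → ℝ) (n : ℕ) : 0 ≤ mean lam x n :=
  mul_nonneg (one_div_nonneg.2 (h.lam_pos n).le)
    (Finset.sum_nonneg fun k _ => mul_nonneg (h.gap_pos k).le (abs_nonneg _))

theorem mean_smul (c : ℝ) (x : ℕ → ℝ) (n : ℕ) :
    mean lam (c • x) n = |c| * mean lam x n := by
  simp only [mean, Pi.smul_apply, smul_eq_mul, abs_mul, Finset.mul_sum]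
  exact Finset.sum_congr rfl fun k _ => by ring

theorem mean_add_le (h : IsLambdaSeq lam) (x y : ℕ → ℝ) (n : ℕ) :
    mean lam (x + y) n ≤ mean lam x n + mean lam y n := by
  simp only [mean]
  rw [← mul_add, ← Finset.sum_add_distrib]
  refine mul_le_mul_of_nonneg_left (Finset.sum_le_sum fun k _ => ?_)
    (one_div_nonneg.2 (h.lam_pos n).le)
  rw [← mul_add]
  exact mul_le_mul_of_nonneg_left (abs_add_le _ _) (h.gap_pos k).le

theorem modular_smul_mono (h : IsLambdaSeq lam) (hp : ∀ n, 1 < p n) {a b : ℝ}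
    (hab : |a| ≤ |b|) (x : ℕ → ℝ) : modular lam p (a • x) ≤ modular lam p (b • x) := by
  refine ENNReal.tsum_le_tsum fun n => ENNReal.ofReal_le_ofReal ?_
  refine Real.rpow_le_rpow (mean_nonneg h _ _) ?_ (zero_lt_one.trans (hp n)).le
  rw [mean_smul, mean_smul]
  exact mul_le_mul_of_nonneg_right hab (mean_nonneg h _ _)

theorem modular_convex (h : IsLambdaSeq lam) (hp : ∀ n, 1 < p n) {a b : ℝ} (ha : 0 ≤ a)
    (hb : 0 ≤ b) (hab : a + b = 1) (x y : ℕ → ℝ) :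
    modular lam p (a • x + b • y) ≤
      ENNReal.ofReal a * modular lam p x + ENNReal.ofReal b * modular lam p y := by
  simp only [modular]
  rw [← ENNReal.tsum_mul_left, ← ENNReal.tsum_mul_left, ← ENNReal.tsum_add]
  refine ENNReal.tsum_le_tsum fun n => ?_
  have hx := mean_nonneg h x n
  have hy := mean_nonneg h y n
  have hp0 : 0 ≤ p n := (zero_lt_one.trans (hp n)).le
  rw [← ENNReal.ofReal_mul ha, ← ENNReal.ofReal_mul hb,
    ← ENNReal.ofReal_add (mul_nonneg ha (Real.rpow_nonneg hx _))
      (mul_nonneg hb (Real.rpow_nonneg hy _))]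
  refine ENNReal.ofReal_le_ofReal ?_
  have h1 : mean lam (a • x + b • y) n ≤ a * mean lam x n + b * mean lam y n := by
    refine (mean_add_le h _ _ n).trans ?_
    rw [mean_smul, mean_smul, abs_of_nonneg ha, abs_of_nonneg hb]
  refine (Real.rpow_le_rpow (mean_nonneg h _ _) h1 hp0).trans ?_
  exact (convexOn_rpow (hp n).le).2 hx hy ha hb hab

theorem modular_zero (hp : ∀ n, 1 < p n) : modular lam p 0 = 0 := by
  simp only [modular, ENNReal.tsum_eq_zero]
  intro n
  have : mean lam 0 n = 0 := by simp [mean]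
  rw [this, Real.zero_rpow (zero_lt_one.trans (hp n)).ne', ENNReal.ofReal_zero]

end lemmas

/-- The set `{x : σ(r x) < ∞ for some r > 0}` as a linear subspace of the space of all real
sequences. -/
def carrier (lam p : ℕ → ℝ) (h : IsLambdaSeq lam) (hp : ∀ n, 1 < p n) :
    Submodule ℝ (ℕ → ℝ) where
  carrier := {x | ∃ r : ℝ, 0 < r ∧ modular lam p (r • x) < ∞}
  zero_mem' := ⟨1, one_pos, by rw [smul_zero, modular_zero hp]; exact ENNReal.zero_lt_top⟩
  add_mem' := by
    rintro x y ⟨r, hr, hx⟩ ⟨s, hs, hy⟩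
    refine ⟨min r s / 2, half_pos (lt_min hr hs), ?_⟩
    have hm : 0 < min r s := lt_min hr hs
    have e : (min r s / 2) • (x + y) =
        (1 / 2 : ℝ) • (min r s • x) + (1 / 2 : ℝ) • (min r s • y) := by
      rw [← smul_add, ← smul_add, smul_smul]; congr 1; ring
    rw [e]
    refine (modular_convex h hp (by norm_num) (by norm_num) (by norm_num) _ _).trans_lt ?_
    refine ENNReal.add_lt_top.2 ⟨ENNReal.mul_lt_top ENNReal.ofReal_lt_top ?_,
      ENNReal.mul_lt_top ENNReal.ofReal_lt_top ?_⟩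
    · refine (modular_smul_mono h hp ?_ x).trans_lt hx
      rw [abs_of_pos hm, abs_of_pos hr]; exact min_le_left _ _
    · refine (modular_smul_mono h hp ?_ y).trans_lt hy
      rw [abs_of_pos hm, abs_of_pos hs]; exact min_le_right _ _
  smul_mem' := by
    rintro c x ⟨r, hr, hx⟩
    have hc : 0 < |c| + 1 := by positivity
    refine ⟨r / (|c| + 1), div_pos hr hc, ?_⟩
    rw [smul_smul]
    refine (modular_smul_mono h hp ?_ x).trans_lt hx
    rw [abs_mul, abs_div, abs_of_pos hr, abs_of_pos hc, div_mul_eq_mul_div, div_le_iff₀ hc]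
    nlinarith

/-- The space `Λ_p̂`. It is a type of its own, so that it carries the topology of the Luxemburg
norm (below) and not the topology of pointwise convergence. -/
def Space (lam p : ℕ → ℝ) (h : IsLambdaSeq lam) (hp : ∀ n, 1 < p n) : Type :=
  carrier lam p h hp

namespace Space

variable {lam p : ℕ → ℝ} {h : IsLambdaSeq lam} {hp : ∀ n, 1 < p n}

instance : AddCommGroup (Space lam p h hp) := inferInstanceAs (AddCommGroup (carrier lam p h hp))

instance : Module ℝ (Space lam p h hp) := inferInstanceAs (Module ℝ (carrier lam p h hp))

/-- The underlying sequence of an element of the space. -/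
def toSeq : Space lam p h hp →ₗ[ℝ] (ℕ → ℝ) := (carrier lam p h hp).subtype

/-- The Luxemburg norm. -/
instance : Norm (Space lam p h hp) := ⟨fun x => luxemburg lam p (toSeq x)⟩

theorem norm_def (x : Space lam p h hp) :
    ‖x‖ = sInf {r : ℝ | 0 < r ∧ modular lam p (r⁻¹ • toSeq x) ≤ 1} := rfl

/-- The set `{x : σ(x) ≤ 1}`. -/
def modularBall (lam p : ℕ → ℝ) (h : IsLambdaSeq lam) (hp : ∀ n, 1 < p n) :
    Set (Space lam p h hp) :=
  {x | modular lam p (toSeq x) ≤ 1}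

theorem exists_modular_le (x : Space lam p h hp) :
    ∃ r : ℝ, 0 < r ∧ modular lam p (r⁻¹ • toSeq x) ≤ 1 := by
  obtain ⟨s, hs, hx⟩ : ∃ r : ℝ, 0 < r ∧ modular lam p (r • toSeq x) < ∞ := x.2
  set M := (modular lam p (s • toSeq x)).toReal with hM
  have hM0 : 0 ≤ M := ENNReal.toReal_nonneg
  have hM1 : 0 < M + 1 := by positivity
  have ht1 : (M + 1)⁻¹ ≤ 1 := inv_le_one_of_one_le₀ (by linarith)
  refine ⟨(M + 1) / s, div_pos hM1 hs, ?_⟩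
  have e : ((M + 1) / s)⁻¹ • toSeq x =
      (M + 1)⁻¹ • (s • toSeq x) + (1 - (M + 1)⁻¹) • (0 : ℕ → ℝ) := by
    rw [smul_zero, add_zero, smul_smul, inv_div, div_eq_inv_mul]
  rw [e]
  refine (modular_convex h hp (by positivity) (sub_nonneg.2 ht1) (by ring) _ _).trans ?_
  rw [modular_zero hp, mul_zero, add_zero, ← ENNReal.ofReal_toReal hx.ne, ← hM,
    ← ENNReal.ofReal_mul (by positivity), ← ENNReal.ofReal_one]
  refine ENNReal.ofReal_le_ofReal ?_
  rw [inv_mul_eq_div, div_le_one hM1]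
  linarith

theorem convex_modularBall : Convex ℝ (modularBall lam p h hp) := by
  intro x hx y hy a b ha hb hab
  change modular lam p (toSeq (a • x + b • y)) ≤ 1
  rw [map_add, map_smul, map_smul]
  refine (modular_convex h hp ha hb hab _ _).trans ?_
  calc _ ≤ ENNReal.ofReal a * 1 + ENNReal.ofReal b * 1 := by
        gcongr
        · exact hx
        · exact hy
    _ = 1 := by rw [mul_one, mul_one, ← ENNReal.ofReal_add ha hb, hab, ENNReal.ofReal_one]

theorem balanced_modularBall : Balanced ℝ (modularBall lam p h hp) := by
  rintro a ha _ ⟨x, hx, rfl⟩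
  change modular lam p (toSeq (a • x)) ≤ 1
  rw [map_smul]
  refine (modular_smul_mono h hp (b := 1) ?_ (toSeq x)).trans ?_
  · simpa using ha
  · rw [one_smul]; exact hx

theorem absorbent_modularBall : Absorbent ℝ (modularBall lam p h hp) := by
  intro x
  obtain ⟨r, hr, hx⟩ := exists_modular_le x
  refine Absorbs.of_norm ⟨r, fun c hc => ?_⟩
  have hc0 : 0 < |c| := hr.trans_le hc
  have hcne : c ≠ 0 := abs_pos.1 hc0
  rw [Set.singleton_subset_iff, Set.mem_smul_set_iff_inv_smul_mem₀ hcne]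
  change modular lam p (toSeq (c⁻¹ • x)) ≤ 1
  rw [map_smul]
  refine (modular_smul_mono h hp ?_ (toSeq x)).trans hx
  rw [abs_inv, abs_inv, abs_of_pos hr]
  exact inv_anti₀ hr hc

theorem norm_eq_gaugeSeminorm (x : Space lam p h hp) :
    ‖x‖ = gaugeSeminorm (𝕜 := ℝ) balanced_modularBall convex_modularBall
      absorbent_modularBall x := by
  change _ = gauge (modularBall lam p h hp) x
  rw [gauge_def', norm_def]
  rfl

theorem eq_zero_of_norm_eq_zero (x : Space lam p h hp) (hx : ‖x‖ = 0) : x = 0 := by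
  have hmean : ∀ n, mean lam (toSeq x) n ≤ ‖x‖ := by
    intro n
    rw [norm_def]
    refine le_csInf (exists_modular_le x) ?_
    rintro r ⟨hr, hle⟩
    have h1 : ENNReal.ofReal (mean lam (r⁻¹ • toSeq x) n ^ p n) ≤ 1 :=
      (ENNReal.le_tsum n).trans hle
    rw [ENNReal.ofReal_le_one] at h1
    have h2 : mean lam (r⁻¹ • toSeq x) n ≤ 1 :=
      not_lt.1 fun hlt => h1.not_gt (Real.one_lt_rpow hlt (zero_lt_one.trans (hp n)))
    rwa [mean_smul, abs_of_pos (inv_pos.2 hr), inv_mul_eq_div, div_le_one hr] at h2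
  have hseq : toSeq x = 0 := by
    funext k
    have h0 : mean lam (toSeq x) k = 0 := le_antisymm ((hmean k).trans hx.le) (mean_nonneg h _ _)
    have h1 : ∑ k ∈ Finset.range (k + 1), gap lam k * |toSeq x k| = 0 := by
      rcases mul_eq_zero.1 h0 with h2 | h2
      · exact absurd h2 (one_div_pos.2 (h.lam_pos k)).ne'
      · exact h2
    rw [Finset.sum_eq_zero_iff_of_nonneg
      fun j _ => mul_nonneg (h.gap_pos j).le (abs_nonneg _)] at h1
    rcases mul_eq_zero.1 (h1 k (Finset.self_mem_range_succ k)) with h2 | h2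
    · exact absurd h2 (h.gap_pos k).ne'
    · exact abs_eq_zero.1 h2
  exact Subtype.ext hseq

theorem core : NormedSpace.Core ℝ (Space lam p h hp) where
  norm_nonneg x := by rw [norm_eq_gaugeSeminorm]; exact apply_nonneg _ _
  norm_smul c x := by
    rw [norm_eq_gaugeSeminorm, norm_eq_gaugeSeminorm]; exact map_smul_eq_mul _ _ _
  norm_triangle x y := by
    rw [norm_eq_gaugeSeminorm, norm_eq_gaugeSeminorm, norm_eq_gaugeSeminorm]
    exact map_add_le_add _ _ _
  norm_eq_zero_iff x := by
    refine ⟨eq_zero_of_norm_eq_zero x, ?_⟩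
    rintro rfl
    rw [norm_eq_gaugeSeminorm, map_zero]

instance : NormedAddCommGroup (Space lam p h hp) := NormedAddCommGroup.ofCore core

instance : NormedSpace ℝ (Space lam p h hp) := NormedSpace.ofCore core

end Space

end LambdaSeq

section WUNS

variable {X : Type*} [NormedAddCommGroup X]

/-- The asymptotic diameter `limsup_k sup_{n, m ≥ k} ‖x n - x m‖`. -/
def asympDiam (x : ℕ → X) : ℝ≥0∞ :=
  limsup (fun k : ℕ => ⨆ (n : ℕ) (m : ℕ) (_ : k ≤ n) (_ : k ≤ m), ‖x n - x m‖ₑ) atTop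

/-- The asymptotic radius `inf {limsup_n ‖x n - y‖ : y ∈ conv (x n)}`. -/
def asympRadius [NormedSpace ℝ X] (x : ℕ → X) : ℝ≥0∞ :=
  ⨅ y ∈ convexHull ℝ (Set.range x), limsup (fun n => ‖x n - y‖ₑ) atTop

variable (X) [NormedSpace ℝ X]

/-- The weakly convergent sequence coefficient: the infimum of the ratios of asymptotic diameter
and asymptotic radius over all sequences that converge weakly but not in norm. It is `∞` if there
are no such sequences. For each such sequence both quantities are finite and positive. -/
def WCS : ℝ≥0∞ :=
  ⨅ (x : ℕ → X)
    (_ : ∃ a : X, Tendsto (fun n => toWeakSpace ℝ X (x n)) atTop (𝓝 (toWeakSpace ℝ X a)))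
    (_ : ¬ ∃ a : X, Tendsto x atTop (𝓝 a)),
    asympDiam x / asympRadius x

/-- Weak uniform normal structure. -/
def HasWUNS : Prop := 1 < WCS X

end WUNS

end

/-! The exponents have a common bound $P$, and $WCS \ge 2^{1/P}$. Let $x_n \to a$ weakly but not in
norm. Coordinates are continuous, so $u_n = x_n - a$ is coordinatewise null; by Mazur's theorem the
asymptotic radius is at most $\limsup \|u_n\|$. It remains to bound the asymptotic diameter below by
$2^{1/P} \limsup \|u_n\|$ (`mul_limsup_enorm_le_asympDiam`). If $D < 2^{1/P}\|u_n\|$, then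
$\sigma(u_n/D) > 1/2$, since a dilation by $2^{1/P}$ at most doubles $\sigma$. Cut $u_n$ to a finite
block $v$ that keeps this bound on its first $N$ terms. For late $m$, the first $N$ terms of
$\sigma((v-u_m)/D)$ are close to those of $\sigma(v/D)$, while beyond $N$ the averages of $|v-u_m|$
dominate those of $|u_m|$. So the two modulars add up and $\sigma((v-u_m)/D) > 1$, that is,
$\|v-u_m\| \ge D$. -/

namespace LambdaSeq

/-! ### Estimates for the modular -/

section modular

variable {lam p : ℕ → ℝ}

theorem mean_mono (h : IsLambdaSeq lam) {x y : ℕ → ℝ} {n : ℕ} (hxy : ∀ k ≤ n, |x k| ≤ |y k|) :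
    mean lam x n ≤ mean lam y n := by
  refine mul_le_mul_of_nonneg_left (Finset.sum_le_sum fun k hk => ?_)
    (one_div_nonneg.2 (h.lam_pos n).le)
  exact mul_le_mul_of_nonneg_left (hxy k (Nat.lt_succ_iff.1 (Finset.mem_range.1 hk)))
    (h.gap_pos k).le

theorem mean_congr {x y : ℕ → ℝ} {n : ℕ} (hxy : ∀ k ≤ n, x k = y k) :
    mean lam x n = mean lam y n := by
  simp only [mean]
  congr 1
  refine Finset.sum_congr rfl fun k hk => ?_
  rw [hxy k (Nat.lt_succ_iff.1 (Finset.mem_range.1 hk))]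

theorem tendsto_mean {y : ℕ → ℕ → ℝ} {z : ℕ → ℝ}
    (hy : ∀ k, Tendsto (fun m => y m k) atTop (𝓝 (z k))) (n : ℕ) :
    Tendsto (fun m => mean lam (y m) n) atTop (𝓝 (mean lam z n)) :=
  (tendsto_finsetSum _ fun k _ => (hy k).abs.const_mul (gap lam k)).const_mul _

theorem tendsto_sum_mean_rpow (hp : ∀ n, 1 < p n) {y : ℕ → ℕ → ℝ} {z : ℕ → ℝ}
    (hy : ∀ k, Tendsto (fun m => y m k) atTop (𝓝 (z k))) (N : ℕ) :
    Tendsto (fun m => ∑ n ∈ Finset.range N, ENNReal.ofReal (mean lam (y m) n ^ p n)) atTop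
      (𝓝 (∑ n ∈ Finset.range N, ENNReal.ofReal (mean lam z n ^ p n))) :=
  tendsto_finsetSum _ fun n _ => ENNReal.tendsto_ofReal
    ((tendsto_mean hy n).rpow_const (Or.inr (zero_lt_one.trans (hp n)).le))

theorem modular_eq_sum_add (x : ℕ → ℝ) (N : ℕ) :
    modular lam p x = ∑ n ∈ Finset.range N, ENNReal.ofReal (mean lam x n ^ p n) +
      ∑' n, ENNReal.ofReal (mean lam x (n + N) ^ p (n + N)) :=
  (ENNReal.summable.sum_add_tsum_nat_add' (k := N)
    (f := fun n => ENNReal.ofReal (mean lam x n ^ p n))).symm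

/-- Beyond the support of `v`, the means of `v - y` dominate those of `y`, provided that `y` is
small compared with `v` on that support. -/
theorem mean_le_mean_sub (h : IsLambdaSeq lam) {v y : ℕ → ℝ} {N n : ℕ}
    (hv : ∀ k, N ≤ k → v k = 0) (hn : N ≤ n)
    (hy : 2 * ∑ k ∈ Finset.range N, gap lam k * |y k| ≤
      ∑ k ∈ Finset.range N, gap lam k * |v k|) :
    mean lam y n ≤ mean lam (v - y) n := by
  refine mul_le_mul_of_nonneg_left ?_ (one_div_nonneg.2 (h.lam_pos n).le)
  have hNn : N ≤ n + 1 := hn.trans n.le_succ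
  rw [← Finset.sum_range_add_sum_Ico _ hNn, ← Finset.sum_range_add_sum_Ico _ hNn]
  refine add_le_add ?_ (Finset.sum_le_sum fun k hk => ?_)
  · have h1 : ∑ k ∈ Finset.range N, gap lam k * |v k| ≤
        ∑ k ∈ Finset.range N, gap lam k * |(v - y) k| +
          ∑ k ∈ Finset.range N, gap lam k * |y k| := by
      rw [← Finset.sum_add_distrib]
      refine Finset.sum_le_sum fun k _ => ?_
      rw [← mul_add]
      refine mul_le_mul_of_nonneg_left ?_ (h.gap_pos k).le
      simpa using abs_add_le ((v - y) k) (y k)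
    linarith
  · simp [hv k (Finset.mem_Ico.1 hk).1]

/-- Almost disjointly supported sequences of modular greater than `1/2` have a difference of
modular greater than `1`. -/
theorem eventually_one_lt_modular_sub (h : IsLambdaSeq lam) (hp : ∀ n, 1 < p n) {v : ℕ → ℝ}
    {N : ℕ} (hv : ∀ k, N ≤ k → v k = 0)
    (hvN : 2⁻¹ < ∑ n ∈ Finset.range N, ENNReal.ofReal (mean lam v n ^ p n)) {y : ℕ → ℕ → ℝ}
    (hy : ∀ k, Tendsto (fun m => y m k) atTop (𝓝 0)) :
    ∀ᶠ m in atTop, 2⁻¹ < modular lam p (y m) → 1 < modular lam p (v - y m) := by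
  -- The weighted sum of $|v|$ must be positive, so that it eventually exceeds twice that of `y m`,
  -- as `mean_le_mean_sub` requires.
  have hS : 0 < ∑ k ∈ Finset.range N, gap lam k * |v k| := by
    have hnn : ∀ k ∈ Finset.range N, 0 ≤ gap lam k * |v k| := fun k _ =>
      mul_nonneg (h.gap_pos k).le (abs_nonneg _)
    refine (Finset.sum_nonneg hnn).lt_of_ne' fun h0 => ?_
    have hv0 : v = 0 := by
      funext k
      rcases lt_or_ge k N with hk | hk
      · have := (Finset.sum_eq_zero_iff_of_nonneg hnn).1 h0 k (Finset.mem_range.2 hk)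
        exact abs_eq_zero.1 ((mul_eq_zero.1 this).resolve_left (h.gap_pos k).ne')
      · exact hv k hk
    have hle : ∑ n ∈ Finset.range N, ENNReal.ofReal (mean lam v n ^ p n) ≤ modular lam p v :=
      ENNReal.sum_le_tsum _
    rw [hv0, modular_zero hp] at hle
    rw [hv0] at hvN
    exact not_lt_bot (hvN.trans_le hle)
  have hsmall : Tendsto (fun m => 2 * ∑ k ∈ Finset.range N, gap lam k * |y m k|) atTop (𝓝 0) := by
    have := (tendsto_finsetSum (Finset.range N)
      fun k _ => (hy k).abs.const_mul (gap lam k)).const_mul 2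
    simpa using this
  have hA := tendsto_sum_mean_rpow (lam := lam) hp (y := fun m => v - y m) (z := v)
    (fun k => by simpa using (hy k).const_sub (v k)) N
  have hB := tendsto_sum_mean_rpow (lam := lam) hp (y := y) (z := 0) hy N
  have hB0 : ∑ n ∈ Finset.range N, ENNReal.ofReal (mean lam 0 n ^ p n) = 0 :=
    le_antisymm ((ENNReal.sum_le_tsum _).trans (modular_zero hp).le) zero_le
  rw [hB0] at hB
  -- The first $N$ terms for `y m` are kept next to $1/2$: with the tail of `y m` they rebuild its
  -- whole modular.
  have hB' := hB.const_add 2⁻¹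
  rw [add_zero] at hB'
  filter_upwards [hB'.eventually_lt hA hvN, hsmall.eventually_lt_const hS] with m hm hs hym
  have htail : ∑' n, ENNReal.ofReal (mean lam (y m) (n + N) ^ p (n + N)) ≤
      ∑' n, ENNReal.ofReal (mean lam (v - y m) (n + N) ^ p (n + N)) := by
    refine ENNReal.tsum_le_tsum fun n => ENNReal.ofReal_le_ofReal ?_
    exact Real.rpow_le_rpow (mean_nonneg h _ _)
      (mean_le_mean_sub h hv (Nat.le_add_left N n) hs.le) (zero_lt_one.trans (hp _)).le
  calc (1 : ℝ≥0∞) = 2⁻¹ + 2⁻¹ := ENNReal.inv_two_add_inv_two.symm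
    _ < 2⁻¹ + modular lam p (y m) := ENNReal.add_lt_add_left (by simp) hym
    _ = _ := by rw [modular_eq_sum_add (y m) N, ← add_assoc]
    _ ≤ _ := add_le_add hm.le htail
    _ = modular lam p (v - y m) := (modular_eq_sum_add _ N).symm

/-- Growth of the modular under dilations when the exponents are bounded. -/
theorem modular_smul_le (h : IsLambdaSeq lam) {P : ℝ} (hP : ∀ n, p n ≤ P) {c : ℝ} (hc : 1 ≤ c)
    (x : ℕ → ℝ) : modular lam p (c • x) ≤ ENNReal.ofReal (c ^ P) * modular lam p x := by
  have hc0 : 0 ≤ c := zero_le_one.trans hc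
  simp only [modular]
  rw [← ENNReal.tsum_mul_left]
  refine ENNReal.tsum_le_tsum fun n => ?_
  rw [← ENNReal.ofReal_mul (Real.rpow_nonneg hc0 _), mean_smul, abs_of_nonneg hc0,
    Real.mul_rpow hc0 (mean_nonneg h _ _)]
  exact ENNReal.ofReal_le_ofReal (mul_le_mul_of_nonneg_right
    (Real.rpow_le_rpow_of_exponent_le hc (hP n)) (Real.rpow_nonneg (mean_nonneg h _ _) _))

/-- The part of a sequence with indices less than `N`. -/
def trunc (N : ℕ) (x : ℕ → ℝ) : ℕ → ℝ := fun k => if k < N then x k else 0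

theorem abs_trunc_le (N : ℕ) (x : ℕ → ℝ) (k : ℕ) : |trunc N x k| ≤ |x k| := by
  by_cases hk : k < N <;> simp [trunc, hk]

theorem abs_sub_trunc_le (N : ℕ) (x : ℕ → ℝ) (k : ℕ) : |(x - trunc N x) k| ≤ |x k| := by
  by_cases hk : k < N <;> simp [trunc, hk]

theorem trunc_smul (N : ℕ) (c : ℝ) (x : ℕ → ℝ) : trunc N (c • x) = c • trunc N x := by
  funext k
  simp [trunc]

/-- Means of index below `N` see only the removed coordinates and vanish; the others are dominated
by those of `x`. -/
theorem modular_sub_trunc_le (h : IsLambdaSeq lam) (hp : ∀ n, 1 < p n) (N : ℕ) (x : ℕ → ℝ) :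
    modular lam p (x - trunc N x) ≤ ∑' n, ENNReal.ofReal (mean lam x (n + N) ^ p (n + N)) := by
  rw [modular_eq_sum_add _ N]
  have h0 : ∑ n ∈ Finset.range N, ENNReal.ofReal (mean lam (x - trunc N x) n ^ p n) = 0 := by
    refine Finset.sum_eq_zero fun n hn => ?_
    have : mean lam (x - trunc N x) n = mean lam 0 n := mean_congr fun k hk => by
      simp [trunc, hk.trans_lt (Finset.mem_range.1 hn)]
    rw [this]
    exact le_antisymm ((ENNReal.le_tsum n).trans (modular_zero hp).le) zero_le
  rw [h0, zero_add]
  exact ENNReal.tsum_le_tsum fun n => ENNReal.ofReal_le_ofReal (Real.rpow_le_rpow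
    (mean_nonneg h _ _) (mean_mono h fun k _ => abs_sub_trunc_le N x k)
    (zero_lt_one.trans (hp _)).le)

end modular

/-! ### Luxemburg norm, coordinates and the diameter estimate -/

namespace Space

variable {lam p : ℕ → ℝ} {h : IsLambdaSeq lam} {hp : ∀ n, 1 < p n}

theorem modular_le_one_of_norm_lt {x : Space lam p h hp} {r : ℝ} (hx : ‖x‖ < r) :
    modular lam p (r⁻¹ • toSeq x) ≤ 1 := by
  rw [norm_def] at hx
  obtain ⟨s, ⟨hs, hle⟩, hsr⟩ := exists_lt_of_csInf_lt (exists_modular_le x) hx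
  refine (modular_smul_mono h hp ?_ _).trans hle
  rw [abs_of_pos (inv_pos.2 hs), abs_of_pos (inv_pos.2 (hs.trans hsr))]
  exact inv_anti₀ hs hsr.le

theorem norm_le_of_modular_le_one {x : Space lam p h hp} {r : ℝ} (hr : 0 < r)
    (hx : modular lam p (r⁻¹ • toSeq x) ≤ 1) : ‖x‖ ≤ r :=
  csInf_le ⟨0, fun _ hs => hs.1.le⟩ ⟨hr, hx⟩

theorem mean_le_norm (x : Space lam p h hp) (n : ℕ) : mean lam (toSeq x) n ≤ ‖x‖ := by
  refine le_csInf (exists_modular_le x) ?_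
  rintro r ⟨hr, hle⟩
  have h1 : ENNReal.ofReal (mean lam (r⁻¹ • toSeq x) n ^ p n) ≤ 1 :=
    (ENNReal.le_tsum n).trans hle
  rw [ENNReal.ofReal_le_one] at h1
  have h2 : mean lam (r⁻¹ • toSeq x) n ≤ 1 :=
    not_lt.1 fun hlt => h1.not_gt (Real.one_lt_rpow hlt (zero_lt_one.trans (hp n)))
  rwa [mean_smul, abs_of_pos (inv_pos.2 hr), inv_mul_eq_div, div_le_one hr] at h2

/-- A single summand of the `k`-th mean is at most the whole. This continuity of coordinates turns
weak convergence into coordinatewise convergence. -/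
theorem abs_toSeq_le (x : Space lam p h hp) (k : ℕ) :
    |toSeq x k| ≤ lam k / gap lam k * ‖x‖ := by
  have h1 : gap lam k * |toSeq x k| ≤ lam k * mean lam (toSeq x) k := by
    rw [mean, ← mul_assoc, mul_one_div_cancel (h.lam_pos k).ne', one_mul]
    exact Finset.single_le_sum (f := fun k => gap lam k * |toSeq x k|)
      (fun j _ => mul_nonneg (h.gap_pos j).le (abs_nonneg _)) (Finset.self_mem_range_succ k)
  rw [div_mul_eq_mul_div, le_div_iff₀ (h.gap_pos k), mul_comm]
  exact h1.trans (mul_le_mul_of_nonneg_left (mean_le_norm x k) (h.lam_pos k).le)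

/-- The coordinate functionals. -/
noncomputable def coord (k : ℕ) : StrongDual ℝ (Space lam p h hp) :=
  LinearMap.mkContinuous (LinearMap.proj k ∘ₗ toSeq) (lam k / gap lam k) fun x => abs_toSeq_le x k

theorem coord_apply (k : ℕ) (x : Space lam p h hp) : coord k x = toSeq x k := rfl

/-- The projection onto the first `N` coordinates. -/
def truncate (N : ℕ) (x : Space lam p h hp) : Space lam p h hp :=
  ⟨trunc N (toSeq x), by
    obtain ⟨r, hr, hx⟩ : ∃ r : ℝ, 0 < r ∧ modular lam p (r • toSeq x) < ∞ := x.2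
    refine ⟨r, hr, lt_of_le_of_lt (ENNReal.tsum_le_tsum fun n => ENNReal.ofReal_le_ofReal ?_) hx⟩
    refine Real.rpow_le_rpow (mean_nonneg h _ _) (mean_mono h fun k _ => ?_)
      (zero_lt_one.trans (hp _)).le
    rw [← trunc_smul]
    exact abs_trunc_le _ _ _⟩

theorem toSeq_truncate (N : ℕ) (x : Space lam p h hp) :
    toSeq (truncate N x) = trunc N (toSeq x) := rfl

/-- Bounded exponents give a $\Delta_2$-type condition: finiteness at one positive dilation spreads
to all. -/
theorem modular_smul_lt_top {P : ℝ} (hP : ∀ n, p n ≤ P) (x : Space lam p h hp) (c : ℝ) :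
    modular lam p (c • toSeq x) < ∞ := by
  obtain ⟨r, hr, hx⟩ : ∃ r : ℝ, 0 < r ∧ modular lam p (r • toSeq x) < ∞ := x.2
  have hb : 1 ≤ max 1 (|c| / r) := le_max_left _ _
  refine lt_of_le_of_lt ((modular_smul_mono h hp (b := max 1 (|c| / r) * r) ?_ _).trans ?_)
    (ENNReal.mul_lt_top (ENNReal.ofReal_lt_top (r := max 1 (|c| / r) ^ P)) hx)
  · rw [abs_of_pos (mul_pos (zero_lt_one.trans_le hb) hr), ← div_le_iff₀ hr]
    exact le_max_right _ _
  · rw [mul_smul]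
    exact modular_smul_le h hP hb _

/-- Order continuity of the norm when the exponents are bounded. -/
theorem eventually_norm_sub_truncate_le {P : ℝ} (hP : ∀ n, p n ≤ P) (x : Space lam p h hp)
    {η : ℝ} (hη : 0 < η) : ∀ᶠ N in atTop, ‖x - truncate N x‖ ≤ η := by
  have htail := ENNReal.tendsto_sum_nat_add
    (fun n => ENNReal.ofReal (mean lam (η⁻¹ • toSeq x) n ^ p n))
    (modular_smul_lt_top hP x η⁻¹).ne
  filter_upwards [htail.eventually_lt_const zero_lt_one] with N hN
  refine norm_le_of_modular_le_one hη ?_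
  rw [map_sub, smul_sub, toSeq_truncate, ← trunc_smul]
  exact (modular_sub_trunc_le h hp N _).trans hN.le

/-- Otherwise dilating by $c = 2^{1/P}$ multiplies the modular by at most $c^P = 2$, which keeps it
at most 1 and gives $\|x\| \le D/c$. -/
theorem inv_two_lt_modular {P : ℝ} (hP0 : 0 < P) (hP : ∀ n, p n ≤ P) {x : Space lam p h hp}
    {D : ℝ} (hD : 0 < D) (hx : D < 2 ^ P⁻¹ * ‖x‖) : 2⁻¹ < modular lam p (D⁻¹ • toSeq x) := by
  set c : ℝ := 2 ^ P⁻¹ with hc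
  have hc1 : 1 ≤ c := Real.one_le_rpow one_le_two (inv_nonneg.2 hP0.le)
  have hc0 : 0 < c := zero_lt_one.trans_le hc1
  by_contra! hle
  refine hx.not_ge ?_
  rw [← le_div_iff₀' hc0]
  refine norm_le_of_modular_le_one (div_pos hD hc0) ?_
  rw [inv_div, div_eq_mul_inv, mul_smul]
  refine (modular_smul_le h hP hc1 _).trans ?_
  rw [hc, ← Real.rpow_mul zero_le_two, inv_mul_cancel₀ hP0.ne', Real.rpow_one, ENNReal.ofReal_ofNat]
  exact (mul_le_mul_right hle 2).trans (ENNReal.mul_inv_cancel two_ne_zero ENNReal.ofNat_ne_top).le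

/-- For a coordinatewise null sequence, the asymptotic diameter exceeds the limit superior of the
norms by a factor that depends only on a bound for the exponents. -/
theorem mul_limsup_enorm_le_asympDiam {P : ℝ} (hP0 : 0 < P) (hP : ∀ n, p n ≤ P)
    {u : ℕ → Space lam p h hp} (hu : ∀ k, Tendsto (fun m => toSeq (u m) k) atTop (𝓝 0)) :
    ENNReal.ofReal (2 ^ P⁻¹) * limsup (fun n => ‖u n‖ₑ) atTop ≤ asympDiam u := by
  have hc0 : (0 : ℝ) < 2 ^ P⁻¹ := Real.rpow_pos_of_pos two_pos _
  by_contra! hlt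
  obtain ⟨D, hD1, hD2⟩ := ENNReal.lt_iff_exists_nnreal_btwn.1 hlt
  -- The gap between `E` and `D` absorbs the truncation error.
  obtain ⟨E, hE1, hE2⟩ := ENNReal.lt_iff_exists_nnreal_btwn.1 hD1
  have hED : (E : ℝ) < D := by exact_mod_cast hE2
  have hD0 : 0 < (D : ℝ) := E.coe_nonneg.trans_lt hED
  obtain ⟨k, hk⟩ := (eventually_lt_of_limsup_lt hE1).exists
  have hdist : ∀ n m, k ≤ n → k ≤ m → ‖u n - u m‖ < E := by
    intro n m hn hm
    have : ‖u n - u m‖ₑ < E :=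
      lt_of_le_of_lt (le_iSup₂_of_le n m (by simp [hn, hm])) hk
    rw [enorm_eq_nnnorm] at this
    exact_mod_cast this
  have hfreq : ∃ᶠ n in atTop, (D : ℝ) < 2 ^ P⁻¹ * ‖u n‖ := by
    have hlim : (D : ℝ≥0∞) / ENNReal.ofReal (2 ^ P⁻¹) < limsup (fun n => ‖u n‖ₑ) atTop := by
      exact ENNReal.div_lt_of_lt_mul' hD2
    refine (frequently_lt_of_lt_limsup (by isBoundedDefault) hlim).mono fun n hn => ?_
    rw [ENNReal.div_lt_iff (Or.inl (by simpa using hc0)) (Or.inl ENNReal.ofReal_ne_top),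
      ← ofReal_norm, ← ENNReal.ofReal_mul (norm_nonneg _), ← ENNReal.ofReal_coe_nnreal,
      ENNReal.ofReal_lt_ofReal_iff_of_nonneg D.coe_nonneg] at hn
    rwa [mul_comm]
  obtain ⟨n, hn, hkn⟩ := (hfreq.and_eventually (eventually_ge_atTop k)).exists
  have hsum := ENNReal.tendsto_nat_tsum
    (fun i => ENNReal.ofReal (mean lam ((D : ℝ)⁻¹ • toSeq (u n)) i ^ p i))
  obtain ⟨N, hN, hN'⟩ := ((hsum.eventually_const_lt (inv_two_lt_modular hP0 hP hD0 hn)).and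
    (eventually_norm_sub_truncate_le hP (u n) (sub_pos.2 hED))).exists
  set v := truncate N (u n) with hv
  have hvN : 2⁻¹ < ∑ i ∈ Finset.range N,
      ENNReal.ofReal (mean lam ((D : ℝ)⁻¹ • toSeq v) i ^ p i) := by
    refine hN.trans_eq (Finset.sum_congr rfl fun i hi => ?_)
    rw [mean_congr fun j hj => ?_]
    simp [hv, toSeq_truncate, trunc, hj.trans_lt (Finset.mem_range.1 hi)]
  have hev := eventually_one_lt_modular_sub h hp (v := (D : ℝ)⁻¹ • toSeq v) (N := N)
    (fun j hj => by simp [hv, toSeq_truncate, trunc, hj.not_gt]) hvN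
    (y := fun m => (D : ℝ)⁻¹ • toSeq (u m)) (fun j => by simpa using (hu j).const_mul (D : ℝ)⁻¹)
  -- The index `m` is chosen after `n` and `N`, so that `u m` is small on the support of `v`.
  obtain ⟨m, hm, hm', hkm⟩ :=
    (hfreq.and_eventually (hev.and (eventually_ge_atTop k))).exists
  refine (hm' (inv_two_lt_modular hP0 hP hD0 hm)).not_ge ?_
  rw [← smul_sub, ← map_sub]
  refine modular_le_one_of_norm_lt ?_
  calc ‖v - u m‖ ≤ ‖v - u n‖ + ‖u n - u m‖ := norm_sub_le_norm_sub_add_norm_sub _ _ _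
    _ < (D - E) + E := add_lt_add_of_le_of_lt (by rwa [norm_sub_rev]) (hdist n m hkn hkm)
    _ = D := sub_add_cancel _ _

end Space

end LambdaSeq

/-! ### Weak convergence, boundedness and the asymptotic radius -/

section WeakConvergence

variable {X : Type*} [NormedAddCommGroup X]

theorem asympDiam_sub_const (x : ℕ → X) (a : X) :
    asympDiam (fun n => x n - a) = asympDiam x := by
  simp only [asympDiam, sub_sub_sub_cancel_right]

variable [NormedSpace ℝ X]

theorem tendsto_apply_of_tendsto_toWeakSpace {x : ℕ → X} {a : X}
    (hx : Tendsto (fun n => toWeakSpace ℝ X (x n)) atTop (𝓝 (toWeakSpace ℝ X a)))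
    (f : StrongDual ℝ X) : Tendsto (fun n => f (x n)) atTop (𝓝 (f a)) :=
  ((WeakBilin.eval_continuous (topDualPairing ℝ X).flip f).tendsto _).comp hx

/-- Weakly convergent sequences are bounded. -/
theorem exists_norm_le_of_tendsto_toWeakSpace {x : ℕ → X} {a : X}
    (hx : Tendsto (fun n => toWeakSpace ℝ X (x n)) atTop (𝓝 (toWeakSpace ℝ X a))) :
    ∃ C, ∀ n, ‖x n‖ ≤ C := by
  -- Uniform boundedness is applied on the dual, which is complete even if `X` is not.
  obtain ⟨C, hC⟩ := banach_steinhaus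
    (g := fun n => NormedSpace.inclusionInDoubleDual ℝ X (x n)) fun f => by
      obtain ⟨C, hC⟩ := (tendsto_apply_of_tendsto_toWeakSpace hx f).norm.bddAbove_range
      exact ⟨C, fun n => hC ⟨n, rfl⟩⟩
  refine ⟨C, fun n => ?_⟩
  rw [← (NormedSpace.inclusionInDoubleDualLi ℝ (E := X)).norm_map (x n)]
  exact hC n

/-- The asymptotic radius is at most the limit superior of the distances to the weak limit. -/
theorem asympRadius_le_limsup_of_tendsto_toWeakSpace {x : ℕ → X} {a : X}
    (hx : Tendsto (fun n => toWeakSpace ℝ X (x n)) atTop (𝓝 (toWeakSpace ℝ X a))) :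
    asympRadius x ≤ limsup (fun n => ‖x n - a‖ₑ) atTop := by
  have ha : a ∈ closure (convexHull ℝ (Set.range x)) := by
    have hmem : toWeakSpace ℝ X a ∈
        closure (toWeakSpace ℝ X '' convexHull ℝ (Set.range x)) :=
      mem_closure_of_tendsto hx (Eventually.of_forall fun n =>
        Set.mem_image_of_mem _ (subset_convexHull ℝ _ ⟨n, rfl⟩))
    -- Mazur: a convex set has the same weak and norm closure.
    rw [← (convex_convexHull ℝ (Set.range x)).toWeakSpace_closure ℝ] at hmem
    obtain ⟨b, hb, hba⟩ := hmem
    rwa [← (toWeakSpace ℝ X).injective hba]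
  refine ENNReal.le_of_forall_pos_le_add fun ε hε _ => ?_
  obtain ⟨y, hy, hya⟩ := EMetric.mem_closure_iff.1 ha ε (by exact_mod_cast hε)
  refine (iInf₂_le y hy).trans ?_
  calc limsup (fun n => ‖x n - y‖ₑ) atTop
      ≤ limsup (fun n => ‖x n - a‖ₑ + ε) atTop := limsup_le_limsup (Eventually.of_forall fun n => by
        beta_reduce
        rw [← sub_add_sub_cancel (x n) a y]
        refine (enorm_add_le _ _).trans ?_
        rw [← edist_eq_enorm_sub a y]
        gcongr)
    _ ≤ limsup (fun n => ‖x n - a‖ₑ) atTop + ε := 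
      (limsup_add_const atTop _ _ (by isBoundedDefault) (by isBoundedDefault)).le

end WeakConvergence

/-! ### Bounded exponents and the conclusion -/

theorem exists_forall_le_of_limsup_lt_top {p : ℕ → ℝ}
    (hlimsup : limsup (fun n => (p n : EReal)) atTop < ⊤) : ∃ P, ∀ n, p n ≤ P := by
  obtain ⟨B, hB1, -⟩ := EReal.lt_iff_exists_real_btwn.1 hlimsup
  have hev : ∀ᶠ n in atTop, p n ≤ B := (eventually_lt_of_limsup_lt hB1).mono fun n hn => by
    exact_mod_cast hn.le
  obtain ⟨P, hP⟩ := IsBoundedUnder.bddAbove_range (f := p) ⟨B, hev⟩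
  exact ⟨P, fun n => hP ⟨n, rfl⟩⟩

theorem corollary3 (lam p : ℕ → ℝ) (hlam : LambdaSeq.IsLambdaSeq lam) (hp : ∀ n, 1 < p n)
    (hlimsup : limsup (fun n => (p n : EReal)) atTop < ⊤) :
    HasWUNS (LambdaSeq.Space lam p hlam hp) := by
  obtain ⟨P, hP⟩ := exists_forall_le_of_limsup_lt_top hlimsup
  have hP0 : 0 < P := zero_lt_one.trans ((hp 0).trans_le (hP 0))
  have hc : 1 < ENNReal.ofReal (2 ^ P⁻¹) :=
    ENNReal.one_lt_ofReal.2 (Real.one_lt_rpow one_lt_two (inv_pos.2 hP0))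
  refine hc.trans_le (le_iInf₂ fun x ⟨a, hx⟩ => le_iInf fun hnot => ?_)
  have hdiam := LambdaSeq.Space.mul_limsup_enorm_le_asympDiam hP0 hP (u := fun n => x n - a)
    fun k => by
      simpa [LambdaSeq.Space.coord_apply] using
        (tendsto_apply_of_tendsto_toWeakSpace hx (LambdaSeq.Space.coord k)).sub_const
          (LambdaSeq.Space.coord k a)
  rw [asympDiam_sub_const] at hdiam
  have hradius := asympRadius_le_limsup_of_tendsto_toWeakSpace hx
  have hpos : limsup (fun n => ‖x n - a‖ₑ) atTop ≠ 0 := fun h0 => hnot ⟨a, by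
    rw [tendsto_iff_edist_tendsto_0]
    simp only [edist_eq_enorm_sub]
    exact tendsto_of_le_liminf_of_limsup_le zero_le h0.le⟩
  have hfin : limsup (fun n => ‖x n - a‖ₑ) atTop ≠ ⊤ := by
    obtain ⟨C, hC⟩ := exists_norm_le_of_tendsto_toWeakSpace hx
    refine (lt_of_le_of_lt (limsup_le_of_le (by isBoundedDefault) (Eventually.of_forall
      fun n => ?_)) (ENNReal.ofReal_lt_top (r := C + ‖a‖))).ne
    rw [← ofReal_norm]
    exact ENNReal.ofReal_le_ofReal ((norm_sub_le _ _).trans (add_le_add_left (hC n) _))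
  -- In $[0,\infty]$ the division needs a finite radius and a nonzero diameter; a zero radius would
  -- then only make the ratio infinite.
  refine (ENNReal.le_div_iff_mul_le (Or.inr fun h0 => ?_)
    (Or.inl (hradius.trans_lt hfin.lt_top).ne)).2 ((mul_le_mul_right hradius _).trans hdiam)
  rw [h0, nonpos_iff_eq_zero, mul_eq_zero] at hdiam
  exact hdiam.elim (zero_lt_one.trans hc).ne' hpos
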